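/- Conventions. For a monoid $M$, $[M^{op},\mathbf{Set}]$ is the category of presheaves on $M$ viewed as a one-object category, i.e. of right $M$-sets. A geometric morphism $\phi:\mathcal E\to\mathcal F$ is a functor $\phi_*:\mathcal E\to\mathcal F$ with a left adjoint $\phi^*$ that preserves finite limits; it is essential if $\phi^*$ has a further left adjoint, and surjective if $\phi^*$ is comonadic. A geometric transformation $\phi\Rightarrow\psi$ is a natural transformation $\phi^*\to\psi^*$. A point of $\mathcal E$ is a geometric morphism $\mathbf{Set}\to\mathcal E$. An object of a topos is an atom if it is not initial and each of its subobjects is either initial or the whole object; a Grothendieck topos is atomic if each of its objects is a (small) coproduct of atoms. Let $\mathbf{Grp}$ be the 2-category of groups, group homomorphisms and conjugations, where a conjugation $\alpha:f\Rightarrow g$ between homomorphisms $f,g:G\to H$ is an element $\alpha\in H$ with $\alpha f(x)=g(x)\alpha$ for all $x\in G$, vertical composition being multiplication in $H$. Let $\mathbf{Grp}^{co}$ be obtained from it by reversing the 2-cells. Let $\mathbf{TOP}^*_{at,ess}$ be the 2-category whose objects are the atomic Grothendieck toposes that have an essential surjective point, whose 1-cells are the essential geometric morphisms and whose 2-cells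 are the geometric transformations. An equivalence of 2-categories is a pseudofunctor that is an equivalence on each hom-category and for which each object of the target is equivalent to one in the image. Theorem. 1. The pseudofunctor that sends a group $G$ to $[G^{op},\mathbf{Set}]$, a homomorphism $f:G\to H$ to the geometric morphism $[G^{op},\mathbf{Set}]\to[H^{op},\mathbf{Set}]$ whose inverse image is restriction along $f$, and a conjugation $\alpha:f\Rightarrow g$ to the transformation $g^*\to f^*$, $x\mapsto x\cdot\alpha$, takes its values in $\mathbf{TOP}^*_{at,ess}$ and is an equivalence of 2-categories $\mathbf{Grp}^{co}\simeq\mathbf{TOP}^*_{at,ess}$. 2. The identity on groups and homomorphisms, together with $\alpha\mapsto\alpha^{-1}$ on conjugations, is an equivalence of 2-categories $\mathbf{Grp}\simeq\mathbf{Grp}^{co}$; composed with the equivalence of part 1 it gives an equivalence of 2-categories $\mathbf{Grp}\simeq\mathbf{TOP}^*_{at,ess}$. 3. For a monoid $M$, the category $[M^{op},\mathbf{Set}]$ is atomic if and only if $M$ is a group. -/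

import Mathlib

open CategoryTheory Bicategory Limits

universe w w₁ w₂ v v₁ v₂ u u₁ u₂

/-! ### Geometric morphisms, essential morphisms, surjections -/

section Toposes

/-- A geometric morphism `E → F`: a direct image functor `E ⥤ F` together with a left adjoint
(the inverse image functor) that preserves finite limits. -/
structure GeomMorphism (E : Type u₁) [Category.{v₁} E] (F : Type u₂) [Category.{v₂} F] where
  direct : E ⥤ F
  inverse : F ⥤ E
  adj : inverse ⊣ direct
  preservesFiniteLimits : PreservesFiniteLimits inverse

namespace GeomMorphism

variable {E : Type u₁} [Category.{v₁} E] {F : Type u₂} [Category.{v₂} F]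

/-- A geometric morphism is essential if its inverse image functor has a further left adjoint. -/
def IsEssential (φ : GeomMorphism E F) : Prop :=
  φ.inverse.IsRightAdjoint

/-- A geometric morphism is surjective if its inverse image functor is comonadic: the comparison
functor to the coalgebras for the induced comonad is an equivalence. -/
def IsSurjective (φ : GeomMorphism E F) : Prop :=
  (Comonad.comparison φ.adj).IsEquivalence

end GeomMorphism

/-- A category is a Grothendieck topos if it is equivalent to the category of sheaves of sets on a
small site. -/
def IsGrothendieckTopos (E : Type (w + 1)) [Category.{w} E] : Prop :=
  ∃ (C : Type w) (_ : SmallCategory C) (J : GrothendieckTopology C),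
    Nonempty (E ≌ Sheaf J (Type w))

/-- `E` has an essential surjective point, i.e. there is an essential surjective geometric morphism
`Set → E`. -/
def HasEssentialSurjectivePoint (E : Type (w + 1)) [Category.{w} E] : Prop :=
  ∃ φ : GeomMorphism (Type w) E, φ.IsEssential ∧ φ.IsSurjective

/-- An object is an atom if it is not initial and its only subobjects are the initial one and
itself. -/
structure IsToposAtom {E : Type u} [Category.{v} E] (A : E) : Prop where
  not_initial : IsEmpty (IsInitial A)
  trivial_subobjects : ∀ ⦃B : E⦄ (i : B ⟶ A), Mono i → Nonempty (IsInitial B) ∨ IsIso i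

/-- `E` is atomic if every object is a (small) coproduct of atoms. -/
def IsAtomicTopos (E : Type (w + 1)) [Category.{w} E] : Prop :=
  ∀ X : E, ∃ (I : Type w) (A : I → E) (ι : ∀ i, A i ⟶ X),
    (∀ i, IsToposAtom (A i)) ∧ Nonempty (IsColimit (Cofan.mk X ι))

end Toposes

/-! ### The 2-category of Grothendieck toposes and essential geometric morphisms -/

/-- Grothendieck toposes. -/
structure Topos : Type (w + 2) where
  carrier : Type (w + 1)
  [category : Category.{w} carrier]
  isGrothendieckTopos : IsGrothendieckTopos.{w} carrier

namespace Topos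

attribute [instance] Topos.category

/-- Essential geometric morphisms. -/
structure Hom (E F : Topos.{w}) where
  geom : GeomMorphism E.carrier F.carrier
  isEssential : geom.IsEssential

/-- Geometric transformations: natural transformations between the inverse image functors. -/
@[ext]
structure Hom₂ {E F : Topos.{w}} (φ ψ : Hom E F) where
  trans : φ.geom.inverse ⟶ ψ.geom.inverse

instance homCategory (E F : Topos.{w}) : Category (Hom E F) where
  Hom φ ψ := Hom₂ φ ψ
  id φ := ⟨𝟙 φ.geom.inverse⟩
  comp α β := ⟨α.trans ≫ β.trans⟩

@[ext]
theorem hom₂_ext {E F : Topos.{w}} {φ ψ : Hom E F} {α β : φ ⟶ ψ} (h : α.trans = β.trans) :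
    α = β :=
  Hom₂.ext h

@[simp]
theorem id_trans {E F : Topos.{w}} (φ : Hom E F) :
    Hom₂.trans (𝟙 φ) = 𝟙 φ.geom.inverse := rfl

@[simp]
theorem comp_trans {E F : Topos.{w}} {φ ψ χ : Hom E F} (α : φ ⟶ ψ) (β : ψ ⟶ χ) :
    Hom₂.trans (α ≫ β) = α.trans ≫ β.trans := rfl

/-- An invertible geometric transformation from a natural isomorphism of inverse images. -/
@[simps]
def isoMk {E F : Topos.{w}} {φ ψ : Hom E F} (α : φ.geom.inverse ≅ ψ.geom.inverse) : φ ≅ ψ where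
  hom := ⟨α.hom⟩
  inv := ⟨α.inv⟩

/-- The identity geometric morphism. -/
def Hom.id (E : Topos.{w}) : Hom E E where
  geom :=
    { direct := 𝟭 _
      inverse := 𝟭 _
      adj := Adjunction.id
      preservesFiniteLimits := inferInstance }
  isEssential := inferInstanceAs (𝟭 E.carrier).IsRightAdjoint

/-- The composite of essential geometric morphisms. -/
def Hom.comp {E F G : Topos.{w}} (φ : Hom E F) (ψ : Hom F G) : Hom E G where
  geom :=
    { direct := φ.geom.direct ⋙ ψ.geom.direct
      inverse := ψ.geom.inverse ⋙ φ.geom.inverse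
      adj := ψ.geom.adj.comp φ.geom.adj
      preservesFiniteLimits :=
        haveI := φ.geom.preservesFiniteLimits
        haveI := ψ.geom.preservesFiniteLimits
        comp_preservesFiniteLimits _ _ }
  isEssential :=
    haveI : φ.geom.inverse.IsRightAdjoint := φ.isEssential
    haveI : ψ.geom.inverse.IsRightAdjoint := ψ.isEssential
    inferInstanceAs (ψ.geom.inverse ⋙ φ.geom.inverse).IsRightAdjoint

/-- The 2-category of Grothendieck toposes, essential geometric morphisms and geometric
transformations. -/
instance bicategory : Bicategory Topos.{w} where
  Hom := Hom
  id := Hom.id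
  comp := Hom.comp
  homCategory := homCategory
  whiskerLeft φ _ _ α := ⟨Functor.whiskerRight α.trans φ.geom.inverse⟩
  whiskerRight α ψ := ⟨Functor.whiskerLeft ψ.geom.inverse α.trans⟩
  associator φ ψ χ :=
    isoMk (Functor.associator χ.geom.inverse ψ.geom.inverse φ.geom.inverse).symm
  leftUnitor φ := isoMk (Functor.rightUnitor φ.geom.inverse)
  rightUnitor φ := isoMk (Functor.leftUnitor φ.geom.inverse)
  whiskerLeft_id _ _ := Hom₂.ext (Functor.whiskerRight_id' _)
  whiskerLeft_comp _ _ _ _ _ _ := Hom₂.ext (Functor.whiskerRight_comp _ _ _)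
  id_whiskerLeft α := Hom₂.ext (NatTrans.ext (funext fun X =>
    (by simp : α.trans.app X = 𝟙 _ ≫ α.trans.app X ≫ 𝟙 _)))
  comp_whiskerLeft φ ψ _ _ α := Hom₂.ext (NatTrans.ext (funext fun X =>
    (by simp : φ.geom.inverse.map (ψ.geom.inverse.map (α.trans.app X)) =
      𝟙 _ ≫ φ.geom.inverse.map (ψ.geom.inverse.map (α.trans.app X)) ≫ 𝟙 _)))
  id_whiskerRight _ _ := Hom₂.ext (Functor.whiskerLeft_id' _)
  comp_whiskerRight _ _ _ := Hom₂.ext (Functor.whiskerLeft_comp _ _ _)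
  whiskerRight_id α := Hom₂.ext (NatTrans.ext (funext fun X =>
    (by simp : α.trans.app X = 𝟙 _ ≫ α.trans.app X ≫ 𝟙 _)))
  whiskerRight_comp α ψ χ := Hom₂.ext (NatTrans.ext (funext fun X =>
    (by simp : α.trans.app (ψ.geom.inverse.obj (χ.geom.inverse.obj X)) =
      𝟙 _ ≫ α.trans.app (ψ.geom.inverse.obj (χ.geom.inverse.obj X)) ≫ 𝟙 _)))
  whisker_assoc φ _ _ α χ := Hom₂.ext (NatTrans.ext (funext fun X =>
    (by simp : φ.geom.inverse.map (α.trans.app (χ.geom.inverse.obj X)) =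
      𝟙 _ ≫ φ.geom.inverse.map (α.trans.app (χ.geom.inverse.obj X)) ≫ 𝟙 _)))
  whisker_exchange α β := Hom₂.ext (NatTrans.ext (funext fun X =>
    α.trans.naturality (β.trans.app X)))
  pentagon φ ψ χ ω := Hom₂.ext (NatTrans.ext (funext fun X =>
    (by simp : 𝟙 _ ≫ 𝟙 _ ≫ φ.geom.inverse.map (𝟙 (ψ.geom.inverse.obj
      (χ.geom.inverse.obj (ω.geom.inverse.obj X)))) = 𝟙 _ ≫ 𝟙 _)))
  triangle φ ψ := Hom₂.ext (NatTrans.ext (funext fun X =>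
    (by simp : 𝟙 _ ≫ φ.geom.inverse.map (𝟙 (ψ.geom.inverse.obj X)) = 𝟙 _)))

end Topos

/-! ### Generalities on bicategories -/

section Bicategories

/-- The bicategory obtained from `B` by reversing the 2-cells. -/
structure Co (B : Type u) where
  as : B

namespace Co

variable {B : Type u} [Bicategory.{w, v} B]

/-- The 1-cells of `Co B` are those of `B`. -/
structure Hom (a b : Co B) where
  as : a.as ⟶ b.as

/-- The 2-cells `f ⟶ g` of `Co B` are the 2-cells `g ⟶ f` of `B`. -/
@[ext]
structure Hom₂ {a b : Co B} (f g : Hom a b) where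
  as : g.as ⟶ f.as

instance homCategory (a b : Co B) : Category (Hom a b) where
  Hom f g := Hom₂ f g
  id f := ⟨𝟙 f.as⟩
  comp η θ := ⟨θ.as ≫ η.as⟩

@[ext]
theorem hom₂_ext {a b : Co B} {f g : Hom a b} {η θ : f ⟶ g} (h : η.as = θ.as) : η = θ :=
  Hom₂.ext h

@[simp]
theorem id_as {a b : Co B} (f : Hom a b) : Hom₂.as (𝟙 f) = 𝟙 f.as := rfl

@[simp]
theorem comp_as {a b : Co B} {f g h : Hom a b} (η : f ⟶ g) (θ : g ⟶ h) :
    Hom₂.as (η ≫ θ) = θ.as ≫ η.as := rfl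

/-- An invertible 2-cell of `B`, seen in `Co B`. -/
@[simps]
def isoMk {a b : Co B} {f g : Hom a b} (η : f.as ≅ g.as) : f ≅ g where
  hom := ⟨η.inv⟩
  inv := ⟨η.hom⟩

instance bicategory : Bicategory (Co B) where
  Hom := Hom
  id a := ⟨𝟙 a.as⟩
  comp f g := ⟨f.as ≫ g.as⟩
  homCategory := homCategory
  whiskerLeft f _ _ η := ⟨f.as ◁ η.as⟩
  whiskerRight η h := ⟨η.as ▷ h.as⟩
  associator f g h := isoMk (α_ f.as g.as h.as)
  leftUnitor f := isoMk (λ_ f.as)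
  rightUnitor f := isoMk (ρ_ f.as)
  whisker_exchange _ _ := by ext; simp [Bicategory.whisker_exchange]

end Co

variable {B : Type u₁} [Bicategory.{w₁, v₁} B] {C : Type u₂} [Bicategory.{w₂, v₂} C]

/-- A pseudofunctor is an equivalence of 2-categories if it is an equivalence on all hom-categories
and every object of the target is equivalent to one in the image. -/
structure IsTwoEquivalence (F : Pseudofunctor B C) : Prop where
  locally_equivalence : ∀ a b : B, (F.mapFunctor a b).IsEquivalence
  essentially_surjective : ∀ c : C, ∃ b : B, Nonempty (Bicategory.Equivalence (F.obj b) c)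

/-- The full sub-2-category of `C` on the objects satisfying `P`. -/
abbrev FullSubTwoCat (P : C → Prop) : Type u₂ :=
  InducedBicategory C (Subtype.val : {c : C // P c} → C)

/-- The corestriction of a pseudofunctor to a full sub-2-category that contains its image. -/
def liftToFullSub (F : Pseudofunctor B C) (P : C → Prop) (hF : ∀ b, P (F.obj b)) :
    Pseudofunctor B (FullSubTwoCat P) where
  obj b := (⟨F.obj b, hF b⟩ : {c : C // P c})
  map f := InducedBicategory.mkHom (F.map f)
  map₂ η := InducedBicategory.mkHom₂ (F.map₂ η)
  mapId b := InducedBicategory.isoMk (F.mapId b)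
  mapComp f g := InducedBicategory.isoMk (F.mapComp f g)

end Bicategories

/-! ### The 2-category of groups -/

/-- Groups. -/
structure GrpTwo : Type (w + 1) where
  carrier : Type w
  [group : Group carrier]

namespace GrpTwo

attribute [instance] GrpTwo.group

/-- A conjugation `f ⇒ g` between homomorphisms `f, g : G → H` is an element `α` of `H` with
`α f(x) = g(x) α` for all `x`. -/
@[ext]
structure Conj {G H : GrpTwo.{w}} (f g : G.carrier →* H.carrier) where
  elt : H.carrier
  comm : ∀ x, elt * f x = g x * elt

instance homCategory (G H : GrpTwo.{w}) : Category (G.carrier →* H.carrier) where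
  Hom f g := Conj f g
  id f := ⟨1, by simp⟩
  comp α β := ⟨β.elt * α.elt, fun x => by
    rw [mul_assoc, α.comm, ← mul_assoc, β.comm, mul_assoc]⟩
  assoc α β γ := Conj.ext (mul_assoc γ.elt β.elt α.elt).symm

@[ext]
theorem conj_ext {G H : GrpTwo.{w}} {f g : G.carrier →* H.carrier} {α β : f ⟶ g}
    (h : α.elt = β.elt) : α = β :=
  Conj.ext h

@[simp]
theorem id_elt {G H : GrpTwo.{w}} (f : G.carrier →* H.carrier) : Conj.elt (𝟙 f) = 1 := rfl

@[simp]
theorem comp_elt {G H : GrpTwo.{w}} {f g h : G.carrier →* H.carrier} (α : f ⟶ g) (β : g ⟶ h) :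
    Conj.elt (α ≫ β) = β.elt * α.elt := rfl

/-- The 2-category of groups, group homomorphisms and conjugations. -/
instance bicategory : Bicategory GrpTwo.{w} where
  Hom G H := G.carrier →* H.carrier
  id G := MonoidHom.id G.carrier
  comp f g := g.comp f
  homCategory := homCategory
  whiskerLeft f _ _ α := ⟨α.elt, fun x => α.comm (f x)⟩
  whiskerRight α h := ⟨h α.elt, fun x => by
    simpa using congrArg h (α.comm x)⟩
  associator f g h := Iso.refl (h.comp (g.comp f))
  leftUnitor f := Iso.refl f
  rightUnitor f := Iso.refl f
  whiskerLeft_id _ _ := by ext; simp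
  whiskerLeft_comp _ _ _ _ _ _ := by ext; simp
  id_whiskerLeft _ := by ext; simp
  comp_whiskerLeft _ _ _ _ _ := by ext; simp
  id_whiskerRight _ _ := by ext; simp
  comp_whiskerRight _ _ _ := by ext; simp
  whiskerRight_id _ := by ext; simp
  whiskerRight_comp _ _ _ := by ext; simp
  whisker_assoc _ _ _ _ _ := by ext; simp
  whisker_exchange α β := by ext; simpa using (β.comm _).symm
  pentagon _ _ _ _ := by ext; simp
  triangle _ _ := by ext; simp

/-- The comparison of the 2-category of groups with its 2-cell dual: the identity on groups and
homomorphisms, `α ↦ α⁻¹` on conjugations. -/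
def toCo : Pseudofunctor GrpTwo.{w} (Co GrpTwo.{w}) where
  obj G := ⟨G⟩
  map f := ⟨f⟩
  map₂ α := ⟨⟨α.elt⁻¹, fun x => by
    rw [inv_mul_eq_iff_eq_mul, ← mul_assoc, α.comm, mul_inv_cancel_right]⟩⟩
  mapId _ := Iso.refl _
  mapComp _ _ := Iso.refl _
  map₂_id _ := Co.Hom₂.ext (Conj.ext inv_one)
  map₂_comp α β := Co.Hom₂.ext (Conj.ext (mul_inv_rev β.elt α.elt))
  map₂_whisker_left _ _ _ α := Co.Hom₂.ext (Conj.ext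
    (by simp : α.elt⁻¹ = 1 * (α.elt⁻¹ * 1)))
  map₂_whisker_right α h := Co.Hom₂.ext (Conj.ext
    ((by simp [MonoidHom.map_inv] : (h.toFun α.elt)⁻¹ = 1 * (h.toFun α.elt⁻¹ * 1))))
  map₂_associator _ _ h := Co.Hom₂.ext (Conj.ext
    (by simp : 1⁻¹ = 1 * (h.toFun 1 * (1 * (1 * 1)))))
  map₂_left_unitor f := Co.Hom₂.ext (Conj.ext
    (by simp : 1⁻¹ = 1 * (f.toFun 1 * 1)))
  map₂_right_unitor {_ H} _ := Co.Hom₂.ext (Conj.ext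
    (by simp : (1 : H.carrier)⁻¹ = 1 * (1 * 1)))

end GrpTwo

/-! ### Toposes of presheaves on groups -/

/-- For a monoid `M`, the category `[Mᵒᵖ, Set]` of right `M`-sets: presheaves on `M` viewed as a
category with one object. -/
abbrev MonoidPresheaf (M : Type w) [Monoid M] : Type (w + 1) :=
  (SingleObj M)ᵒᵖ ⥤ Type w

theorem isGrothendieckTopos_monoidPresheaf (M : Type w) [Monoid M] :
    IsGrothendieckTopos.{w} (MonoidPresheaf M) :=
  ⟨AsSmall.{w} (SingleObj M), inferInstance, ⊥,
    ⟨(AsSmall.equiv (C := SingleObj M)).op.congrLeft.trans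
      (sheafBotEquivalence (Type w)).symm⟩⟩

namespace GrpTwo

/-- The geometric morphism `[Gᵒᵖ, Set] → [Hᵒᵖ, Set]` induced by a homomorphism `f : G → H`: its
inverse image is restriction along `f` and its direct image is right Kan extension along `f`. -/
noncomputable def presheafGeom {G H : GrpTwo.{w}} (f : G.carrier →* H.carrier) :
    GeomMorphism (MonoidPresheaf G.carrier) (MonoidPresheaf H.carrier) where
  direct := (SingleObj.mapHom _ _ f).op.ran
  inverse := (Functor.whiskeringLeft _ _ _).obj (SingleObj.mapHom _ _ f).op
  adj := (SingleObj.mapHom _ _ f).op.ranAdjunction (Type w)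
  preservesFiniteLimits := inferInstance

theorem presheafGeom_isEssential {G H : GrpTwo.{w}} (f : G.carrier →* H.carrier) :
    (presheafGeom f).IsEssential :=
  ((SingleObj.mapHom _ _ f).op.lanAdjunction (Type w)).isRightAdjoint

/-- A conjugation, viewed as a natural transformation of functors between one-object categories. -/
def Conj.toNatTrans {G H : GrpTwo.{w}} {f g : G.carrier →* H.carrier} (α : Conj f g) :
    SingleObj.mapHom _ _ f ⟶ SingleObj.mapHom _ _ g where
  app _ := α.elt
  naturality _ _ x := α.comm x

/-- The mapping `G ↦ [Gᵒᵖ, Set]`, on homomorphisms `f` the geometric morphism whose inverse image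
is restriction along `f`, and on a conjugation `α : f ⇒ g` the transformation `x ↦ x · α` from
restriction along `g` to restriction along `f`. -/
noncomputable def presheafTopos : Pseudofunctor (Co GrpTwo.{w}) Topos.{w} where
  obj G := ⟨MonoidPresheaf G.as.carrier, isGrothendieckTopos_monoidPresheaf _⟩
  map f := ⟨presheafGeom f.as, presheafGeom_isEssential f.as⟩
  map₂ α := ⟨(Functor.whiskeringLeft _ _ _).map (NatTrans.op (Conj.toNatTrans α.as))⟩
  mapId G := Topos.isoMk (NatIso.ofComponents fun Y => NatIso.ofComponents fun X => Iso.refl _)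
  mapComp f g := Topos.isoMk
    (NatIso.ofComponents fun Y => NatIso.ofComponents fun X => Iso.refl _)
  map₂_id _ := Topos.Hom₂.ext (NatTrans.ext (funext fun Y => NatTrans.ext (funext fun X =>
    Y.map_id X)))
  map₂_comp α β := Topos.Hom₂.ext (NatTrans.ext (funext fun Y => NatTrans.ext (funext fun X =>
    Y.map_comp ((Conj.toNatTrans α.as).app X.unop).op ((Conj.toNatTrans β.as).app X.unop).op)))
  map₂_associator {_ _ _ D} f g h := Topos.Hom₂.ext (NatTrans.ext (funext fun Y =>
    NatTrans.ext (funext fun X => by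
      change Y.map (𝟙 (Opposite.op (SingleObj.star D.as.carrier))) =
        𝟙 _ ≫ 𝟙 _ ≫ 𝟙 _ ≫ 𝟙 _ ≫ 𝟙 _
      simp)))
  map₂_left_unitor {_ B} f := Topos.Hom₂.ext (NatTrans.ext (funext fun Y =>
    NatTrans.ext (funext fun X => by
      change Y.map (𝟙 (Opposite.op (SingleObj.star B.as.carrier))) = 𝟙 _ ≫ 𝟙 _ ≫ 𝟙 _
      simp)))
  map₂_right_unitor {_ B} f := Topos.Hom₂.ext (NatTrans.ext (funext fun Y =>
    NatTrans.ext (funext fun X => by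
      change Y.map (𝟙 (Opposite.op (SingleObj.star B.as.carrier))) = 𝟙 _ ≫ 𝟙 _ ≫ 𝟙 _
      simp)))

end GrpTwo

/-- The atomic Grothendieck toposes with an essential surjective point, among all Grothendieck
toposes. -/
def Topos.IsAtomicWithPoint (E : Topos.{w}) : Prop :=
  IsAtomicTopos E.carrier ∧ HasEssentialSurjectivePoint E.carrier

/-! Everything rests on the right regular `M`-set: it is free on the element 1, so its maps to `Y`
are the elements of `Y` (`ofElt`, `hom_ext_regular`).

Atomicity: over a group, each right set is the disjoint union of its orbits, and orbits are atoms.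
Conversely, if the regular `M`-set is a coproduct of atoms, the summand containing 1 contains a copy
of the whole regular set, which is therefore an atom. So `xM = M` for every `x`, every element has a
right inverse, and `M` is a group.

Hom-categories: by Yoneda a transformation between restriction functors is `y ↦ y · a` for one
element `a`, and equivariance says exactly that `a` is a conjugation
(`exists_conj_of_restrict_hom`). For 1-cells, an essential inverse image followed by the forgetful
functor preserves colimits and is corepresentable. Its corepresenting object must be a single free
orbit, so the functor is the forgetful functor up to isomorphism (`exists_universal_element`).
Transporting the action of `G` through this identification produces the homomorphism `G → H`
(`exists_iso_restrict`).

Objects: the inverse image of an essential surjective point is a conservative functor to sets with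
adjoints on both sides, hence of the form `Hom(P, -)`. The lift of `Hom(P, -)` to right `End P`-sets
has a left adjoint, by cocompleteness, whose unit is invertible on the regular set, hence on all its
colimits; conservativity makes it an equivalence (`exists_equivalence_of_essential_point`).
Atomicity then forces `End P` to be a group. -/

/-! ### Presheaves on a monoid as right actions -/

namespace MonoidPresheaf

variable {M : Type w} [Monoid M]

/-- The underlying set of a right `M`-set. -/
abbrev Carrier (Y : MonoidPresheaf M) : Type w :=
  Y.obj (Opposite.op (SingleObj.star M))

/-- The right action of `M`. -/
def act (Y : MonoidPresheaf M) (y : Carrier Y) (m : M) : Carrier Y :=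
  Y.map (Quiver.Hom.op (show SingleObj.star M ⟶ SingleObj.star M from m)) y

theorem act_one (Y : MonoidPresheaf M) (y : Carrier Y) : act Y y 1 = y :=
  congrArg (fun f : Carrier Y ⟶ Carrier Y => f y) (Y.map_id _)

theorem act_mul (Y : MonoidPresheaf M) (y : Carrier Y) (m n : M) :
    act Y y (m * n) = act Y (act Y y m) n :=
  congrArg (fun f : Carrier Y ⟶ Carrier Y => f y)
    (Y.map_comp (Quiver.Hom.op (show SingleObj.star M ⟶ SingleObj.star M from m))
      (Quiver.Hom.op (show SingleObj.star M ⟶ SingleObj.star M from n)))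

/-- A right `M`-set as a presheaf. -/
def ofAct (X : Type w) (a : X → M → X) (h₁ : ∀ x, a x 1 = x)
    (h₂ : ∀ x m n, a x (m * n) = a (a x m) n) : MonoidPresheaf M where
  obj _ := X
  map f := ↾fun x => a x f.unop
  map_id _ := by
    ext x
    exact h₁ x
  map_comp f g := by
    ext x
    exact h₂ x f.unop g.unop

/-- The equivariant map underlying a morphism of presheaves. -/
def toFun {Y Z : MonoidPresheaf M} (η : Y ⟶ Z) (y : Carrier Y) : Carrier Z :=
  η.app (Opposite.op (SingleObj.star M)) y

theorem toFun_act {Y Z : MonoidPresheaf M} (η : Y ⟶ Z) (y : Carrier Y) (m : M) :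
    toFun η (act Y y m) = act Z (toFun η y) m :=
  NatTrans.naturality_apply η (Quiver.Hom.op (show SingleObj.star M ⟶ SingleObj.star M from m)) y

theorem toFun_comp {X Y Z : MonoidPresheaf M} (η : X ⟶ Y) (θ : Y ⟶ Z) (x : Carrier X) :
    toFun (η ≫ θ) x = toFun θ (toFun η x) := rfl

theorem toFun_id (X : MonoidPresheaf M) (x : Carrier X) : toFun (𝟙 X) x = x := rfl

theorem hom_ext {Y Z : MonoidPresheaf M} {η θ : Y ⟶ Z} (h : ∀ y, toFun η y = toFun θ y) :
    η = θ := by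
  ext ⟨⟨⟩⟩ y
  exact h y

/-- A morphism of presheaves from an equivariant map. -/
def homMk {Y Z : MonoidPresheaf M} (f : Carrier Y → Carrier Z)
    (h : ∀ y m, f (act Y y m) = act Z (f y) m) : Y ⟶ Z where
  app _ := ↾f
  naturality _ _ m := by
    ext y
    exact h y m.unop

theorem toFun_homMk {Y Z : MonoidPresheaf M} (f : Carrier Y → Carrier Z)
    (h : ∀ y m, f (act Y y m) = act Z (f y) m) (y : Carrier Y) : toFun (homMk f h) y = f y := rfl

theorem isIso_of_bijective {Y Z : MonoidPresheaf M} (η : Y ⟶ Z)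
    (h : Function.Bijective (toFun η)) : IsIso η := by
  rw [NatTrans.isIso_iff_isIso_app]
  intro c
  rw [isIso_iff_bijective]
  exact h

theorem bijective_of_isIso {Y Z : MonoidPresheaf M} (η : Y ⟶ Z) [IsIso η] :
    Function.Bijective (toFun η) :=
  (isIso_iff_bijective (η.app (Opposite.op (SingleObj.star M)))).1 inferInstance

theorem injective_of_mono {Y Z : MonoidPresheaf M} (η : Y ⟶ Z) [Mono η] :
    Function.Injective (toFun η) :=
  (mono_iff_injective (η.app (Opposite.op (SingleObj.star M)))).1 inferInstance

theorem epi_of_surjective {Y Z : MonoidPresheaf M} (η : Y ⟶ Z)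
    (h : Function.Surjective (toFun η)) : Epi η := by
  have (c : (SingleObj M)ᵒᵖ) : Epi (η.app c) := (epi_iff_surjective _).2 h
  exact NatTrans.epi_of_epi_app η

/-- The empty presheaf is initial. -/
def isInitialOfIsEmpty (Y : MonoidPresheaf M) [h : IsEmpty (Carrier Y)] : IsInitial Y :=
  IsInitial.ofUniqueHom (fun _ => homMk (fun y => h.elim y) (fun y => h.elim y))
    (fun _ _ => hom_ext fun y => h.elim y)

theorem isEmpty_of_isInitial {Y : MonoidPresheaf M} (h : IsInitial Y) : IsEmpty (Carrier Y) :=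
  ⟨fun y => PEmpty.elim (toFun (h.to
    (ofAct PEmpty (fun x _ => x) (fun _ => rfl) (fun _ _ _ => rfl))) y)⟩

variable (M) in
/-- The right regular `M`-set. -/
def regular : MonoidPresheaf M :=
  ofAct M (fun x m => x * m) mul_one (fun x m n => (mul_assoc x m n).symm)

/-- The morphism from the right regular `M`-set given by an element. -/
def ofElt {Y : MonoidPresheaf M} (y : Carrier Y) : regular M ⟶ Y :=
  homMk (fun m : M => act Y y m) (fun m n => act_mul Y y m n)

theorem toFun_regular {Y : MonoidPresheaf M} (η : regular M ⟶ Y) (m : M) :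
    toFun η m = act Y (toFun η (1 : M)) m :=
  (congrArg (toFun η) (one_mul m).symm).trans (toFun_act η _ m)

theorem hom_ext_regular {Y : MonoidPresheaf M} {η θ : regular M ⟶ Y}
    (h : toFun η (1 : M) = toFun θ (1 : M)) : η = θ :=
  hom_ext fun (m : M) => (toFun_regular η m).trans (h ▸ (toFun_regular θ m).symm)

theorem ofElt_comp {Y Z : MonoidPresheaf M} (y : Carrier Y) (η : Y ⟶ Z) :
    ofElt y ≫ η = ofElt (toFun η y) :=
  hom_ext fun (m : M) => toFun_act η y m

theorem toFun_ofElt_one {Y : MonoidPresheaf M} (y : Carrier Y) :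
    toFun (ofElt y) (1 : M) = y :=
  act_one Y y

theorem exists_toFun_of_isColimit {Y : MonoidPresheaf M} {I : Type w} {A : I → MonoidPresheaf M}
    {ι : ∀ i, A i ⟶ Y} (h : IsColimit (Cofan.mk Y ι)) (y : Carrier Y) :
    ∃ i a, toFun (ι i) a = y := by
  obtain ⟨⟨i⟩, a, ha⟩ := Types.jointly_surjective_of_isColimit
    (isColimitOfPreserves ((evaluation _ _).obj (Opposite.op (SingleObj.star M))) h) y
  exact ⟨i, a, ha⟩

theorem isToposAtom_of_transitive (Y : MonoidPresheaf M) (hne : Nonempty (Carrier Y))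
    (h : ∀ y z : Carrier Y, ∃ m, act Y y m = z) : IsToposAtom Y where
  not_initial := ⟨fun hi => (isEmpty_of_isInitial hi).elim hne.some⟩
  trivial_subobjects B i _ := by
    rcases isEmpty_or_nonempty (Carrier B) with hB | ⟨⟨b⟩⟩
    · exact Or.inl ⟨isInitialOfIsEmpty B⟩
    · refine Or.inr (isIso_of_bijective i ⟨injective_of_mono i, fun y => ?_⟩)
      obtain ⟨m, rfl⟩ := h (toFun i b) y
      exact ⟨act B b m, toFun_act i b m⟩

/-- The image is a subobject of an atom, and the given element keeps it from being initial. -/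
theorem surjective_of_isToposAtom {Y Z : MonoidPresheaf M} (hZ : IsToposAtom Z) (η : Y ⟶ Z)
    (y : Carrier Y) : Function.Surjective (toFun η) := by
  rcases hZ.trivial_subobjects (Subfunctor.range η).ι inferInstance with ⟨⟨h⟩⟩ | h
  · exact ((isEmpty_of_isInitial h).false (toFun (Subfunctor.toRange η) y)).elim
  · intro z
    obtain ⟨⟨_, x, hx⟩, rfl⟩ := (bijective_of_isIso (Subfunctor.range η).ι).2 z
    exact ⟨x, hx⟩

/-! ### Atomicity -/

section Group

variable {G : Type w} [Group G]

theorem act_inv_act (Y : MonoidPresheaf G) (y : Carrier Y) (g : G) :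
    act Y (act Y y g) g⁻¹ = y := by
  rw [← act_mul, mul_inv_cancel, act_one]

/-- Two elements of a right `G`-set are equivalent if they lie in the same orbit. -/
def orbitSetoid (Y : MonoidPresheaf G) : Setoid (Carrier Y) where
  r y z := ∃ g, act Y y g = z
  iseqv :=
    { refl y := ⟨1, act_one Y y⟩
      symm := by
        rintro y _ ⟨g, rfl⟩
        exact ⟨g⁻¹, act_inv_act Y y g⟩
      trans := by
        rintro y _ _ ⟨g, rfl⟩ ⟨h, rfl⟩
        exact ⟨g * h, act_mul Y y g h⟩ }

theorem mk_act (Y : MonoidPresheaf G) (y : Carrier Y) (g : G) :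
    Quotient.mk (orbitSetoid Y) (act Y y g) = Quotient.mk (orbitSetoid Y) y :=
  Quotient.sound ((orbitSetoid Y).symm ⟨g, rfl⟩)

/-- An orbit of a right `G`-set. -/
def orbit (Y : MonoidPresheaf G) (q : Quotient (orbitSetoid Y)) : MonoidPresheaf G :=
  ofAct {y : Carrier Y // Quotient.mk (orbitSetoid Y) y = q}
    (fun y g => ⟨act Y y.1 g, (mk_act Y y.1 g).trans y.2⟩)
    (fun y => Subtype.ext (act_one Y y.1)) (fun y g h => Subtype.ext (act_mul Y y.1 g h))

/-- The inclusion of an orbit. -/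
def orbitι (Y : MonoidPresheaf G) (q : Quotient (orbitSetoid Y)) : orbit Y q ⟶ Y :=
  homMk (fun y : {y : Carrier Y // Quotient.mk (orbitSetoid Y) y = q} => y.1) (fun _ _ => rfl)

theorem isToposAtom_orbit (Y : MonoidPresheaf G) (q : Quotient (orbitSetoid Y)) :
    IsToposAtom (orbit Y q) := by
  refine isToposAtom_of_transitive _ ?_ ?_
  · obtain ⟨y, rfl⟩ := Quotient.exists_rep q
    exact ⟨⟨y, rfl⟩⟩
  · rintro ⟨y, rfl⟩ ⟨z, hz⟩
    obtain ⟨g, hg⟩ := Quotient.exact hz.symm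
    exact ⟨g, Subtype.ext hg⟩

/-- A right `G`-set is the coproduct of its orbits. -/
def isColimitOrbits (Y : MonoidPresheaf G) : IsColimit (Cofan.mk Y (orbitι Y)) :=
  Cofan.IsColimit.mk _
    (fun s => homMk (fun y => toFun (s.inj (Quotient.mk _ y)) ⟨y, rfl⟩) (fun y g => by
      -- The classes of `y` and `act Y y g` are equal but not definitionally so; the class is
      -- generalized to `q` so that the dependent types can be transported.
      have key (q) (hq : Quotient.mk (orbitSetoid Y) y = q) :
          toFun (s.inj q) ⟨act Y y g, (mk_act Y y g).trans hq⟩ =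
            act s.pt (toFun (s.inj q) ⟨y, hq⟩) g :=
        toFun_act (s.inj q) ⟨y, hq⟩ g
      rw [← key]
      have key₂ (q) (hq : Quotient.mk (orbitSetoid Y) (act Y y g) = q) :
          toFun (s.inj (Quotient.mk _ (act Y y g))) ⟨act Y y g, rfl⟩ =
            toFun (s.inj q) ⟨act Y y g, hq⟩ := by
        subst hq
        rfl
      exact key₂ _ _))
    (fun s q => hom_ext (by
      rintro ⟨y, rfl⟩
      rfl))
    (fun s m hm => hom_ext fun y => by
      rw [toFun_homMk, ← hm]
      rfl)

variable (G) in
theorem isAtomicTopos_of_group : IsAtomicTopos (MonoidPresheaf G) := fun Y =>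
  ⟨Quotient (orbitSetoid Y), orbit Y, orbitι Y, isToposAtom_orbit Y, ⟨isColimitOrbits Y⟩⟩

end Group

theorem isUnit_of_isAtomicTopos (h : IsAtomicTopos (MonoidPresheaf M)) (m : M) : IsUnit m := by
  obtain ⟨I, A, ι, hA, ⟨hc⟩⟩ := h (regular M)
  -- The summand that contains 1: its inclusion is split by the map that sends 1 to `a`.
  obtain ⟨i, a, ha⟩ := exists_toFun_of_isColimit hc (1 : M)
  have hs : ofElt a ≫ ι i = 𝟙 (regular M) := by
    rw [ofElt_comp, ha]
    exact hom_ext_regular (mul_one (1 : M))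
  have : Mono (ofElt a) := mono_of_mono_fac hs
  rcases (hA i).trivial_subobjects (ofElt a) this with ⟨⟨hi⟩⟩ | hi
  · exact ((isEmpty_of_isInitial hi).false (1 : M)).elim
  -- Left multiplication by `x`, followed by the embedding into the atom, is onto and so reaches the
  -- image of 1.
  · have inv (x : M) : ∃ y, x * y = 1 := by
      obtain ⟨y, hy⟩ := surjective_of_isToposAtom (hA i) (ofElt (Y := regular M) x ≫ ofElt a)
        (1 : M) (toFun (ofElt a) (1 : M))
      exact ⟨y, (bijective_of_isIso (ofElt a)).1 hy⟩
    obtain ⟨n, hn⟩ := inv m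
    obtain ⟨k, hk⟩ := inv n
    have : m = k := by rw [← mul_one m, ← hk, ← mul_assoc, hn, one_mul]
    exact ⟨⟨m, n, hn, this ▸ hk⟩, rfl⟩

theorem isAtomicTopos_iff : IsAtomicTopos (MonoidPresheaf M) ↔ ∀ m : M, IsUnit m := by
  refine ⟨isUnit_of_isAtomicTopos, fun h => ?_⟩
  let _ : Group M := groupOfIsUnit h
  exact isAtomicTopos_of_group M

end MonoidPresheaf

/-! ### Invariance of atomicity under equivalence -/

theorem IsToposAtom.of_equivalence {E : Type u₁} [Category.{v₁} E] {F : Type u₂}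
    [Category.{v₂} F] (e : E ≌ F) {A : E} (hA : IsToposAtom A) : IsToposAtom (e.functor.obj A) where
  not_initial := ⟨fun h => hA.not_initial.elim (IsInitial.isInitialOfObj e.functor A h)⟩
  trivial_subobjects B i _ := by
    have hm : Mono (e.inverse.map i ≫ e.unitInv.app A) := inferInstance
    rcases hA.trivial_subobjects _ hm with ⟨⟨h⟩⟩ | h
    · exact Or.inl ⟨IsInitial.isInitialOfObj e.inverse B h⟩
    · have : IsIso (e.inverse.map i) := IsIso.of_isIso_comp_right _ (e.unitInv.app A)
      exact Or.inr (isIso_of_reflects_iso i e.inverse)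

theorem IsAtomicTopos.of_equivalence {E : Type (w + 1)} [Category.{w} E] {F : Type (w + 1)}
    [Category.{w} F] (e : E ≌ F) (hE : IsAtomicTopos E) : IsAtomicTopos F := fun X => by
  obtain ⟨I, A, ι, hA, ⟨hc⟩⟩ := hE (e.inverse.obj X)
  refine ⟨I, fun i => e.functor.obj (A i), fun i => e.functor.map (ι i) ≫ e.counit.app X,
    fun i => (hA i).of_equivalence e, ⟨?_⟩⟩
  exact Cofan.IsColimit.mk _
    (fun s => e.counitInv.app X ≫ e.functor.map
      (Cofan.IsColimit.desc hc fun i => e.unit.app (A i) ≫ e.inverse.map (s.inj i)) ≫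
        e.counit.app s.pt)
    (fun s i => by
      have := Cofan.IsColimit.fac hc (fun i => e.unit.app (A i) ≫ e.inverse.map (s.inj i)) i
      dsimp at this ⊢
      simp [← Functor.map_comp_assoc, this])
    (fun s m hm => by
      have : e.inverse.map m ≫ 𝟙 _ = Cofan.IsColimit.desc hc
          (fun i => e.unit.app (A i) ≫ e.inverse.map (s.inj i)) := by
        refine Cofan.IsColimit.hom_ext hc _ _ fun i => ?_
        rw [Cofan.IsColimit.fac]
        simp [← hm]
      simp [← this])

/-! ### Groups, conjugations and their inverses -/

namespace GrpTwo

/-- The inverse of a conjugation. -/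
def Conj.symm {G H : GrpTwo.{w}} {f g : G.carrier →* H.carrier} (α : Conj f g) : Conj g f where
  elt := α.elt⁻¹
  comm x := by rw [inv_mul_eq_iff_eq_mul, ← mul_assoc, α.comm, mul_inv_cancel_right]

theorem isTwoEquivalence_toCo : IsTwoEquivalence GrpTwo.toCo.{w} where
  locally_equivalence G H :=
    { faithful := ⟨fun {f g} α β h => Conj.ext (inv_injective
        (congrArg (fun θ : Co.Hom₂ (B := GrpTwo.{w}) ⟨f⟩ ⟨g⟩ => θ.as.elt) h))⟩
      full := ⟨fun {f g} θ => by
        let α : Conj g f := Co.Hom₂.as θ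
        exact ⟨α.symm, Co.Hom₂.ext (Conj.ext (inv_inv α.elt))⟩⟩
      essSurj := ⟨fun f => ⟨f.as, ⟨Iso.refl _⟩⟩⟩ }
  essentially_surjective G := ⟨G.as, ⟨Bicategory.Equivalence.id G⟩⟩

end GrpTwo

theorem GrpTwo.isTwoEquivalence_toCo_comp {C : Type u₂} [Bicategory.{w₂, v₂} C]
    (F : Pseudofunctor (Co GrpTwo.{w}) C) (hF : IsTwoEquivalence F) :
    IsTwoEquivalence (GrpTwo.toCo.{w}.comp F) where
  locally_equivalence G H := by
    have h₁ := GrpTwo.isTwoEquivalence_toCo.{w}.locally_equivalence G H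
    have h₂ := hF.locally_equivalence (GrpTwo.toCo.obj G) (GrpTwo.toCo.obj H)
    exact inferInstanceAs (GrpTwo.toCo.mapFunctor G H ⋙
      F.mapFunctor (GrpTwo.toCo.obj G) (GrpTwo.toCo.obj H)).IsEquivalence
  essentially_surjective c := by
    obtain ⟨G, h⟩ := hF.essentially_surjective c
    exact ⟨G.as, h⟩

namespace MonoidPresheaf

/-! ### The canonical point of a topos of presheaves on a monoid -/

variable (M : Type w) [Monoid M]

/-- The forgetful functor from right `M`-sets to sets. -/
abbrev forget : MonoidPresheaf M ⥤ Type w :=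
  (evaluation _ _).obj (Opposite.op (SingleObj.star M))

instance : (forget M).ReflectsIsomorphisms where
  reflects η h := by
    rw [NatTrans.isIso_iff_isIso_app]
    exact fun _ => h

/-- The point of `[Mᵒᵖ, Set]` whose inverse image is the forgetful functor. -/
noncomputable def point : GeomMorphism (Type w) (MonoidPresheaf M) where
  direct := evaluationRightAdjoint (Type w) (Opposite.op (SingleObj.star M))
  inverse := forget M
  adj := evaluationAdjunctionLeft (Type w) (Opposite.op (SingleObj.star M))
  preservesFiniteLimits := inferInstance

/-- Evaluation at the only object has adjoints on both sides, preserves limits and is conservative;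
comonadicity follows from the monadicity criterion in its dual, coreflexive form. -/
theorem hasEssentialSurjectivePoint : HasEssentialSurjectivePoint (MonoidPresheaf M) := by
  refine ⟨point M, evaluationIsRightAdjoint (Type w) (Opposite.op (SingleObj.star M)), ?_⟩
  have : Comonad.PreservesLimitOfIsCoreflexivePair (forget M) :=
    ⟨fun _ _ _ _ _ => inferInstance⟩
  exact (Comonad.comonadicOfHasPreservesCoreflexiveEqualizersOfReflectsIsomorphisms
    (F := forget M) (point M).adj).eqv

end MonoidPresheaf

/-! ### Essential points of toposes of presheaves on a group -/

/-- The left adjoint applied to a one-point set corepresents `T`, since elements of `T Y` are maps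
from the point. -/
theorem exists_corepresenting {E : Type u} [Category.{w} E] (T : E ⥤ Type w)
    [hr : T.IsRightAdjoint] :
    ∃ (P : E) (u : T.obj P), ∀ Y : E, Function.Bijective fun h : P ⟶ Y => T.map h u := by
  obtain ⟨L, ⟨adj⟩⟩ := hr.exists_leftAdjoint
  refine ⟨L.obj PUnit, adj.unit.app PUnit PUnit.unit, fun Y => ?_⟩
  refine ⟨fun h k hhk => (adj.homEquiv _ _).injective ?_, fun y => ?_⟩
  · rw [adj.homEquiv_unit, adj.homEquiv_unit]
    ext ⟨⟩
    exact hhk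
  · refine ⟨(adj.homEquiv _ _).symm (↾fun _ => y), ?_⟩
    have := adj.homEquiv_unit (f := (adj.homEquiv _ _).symm (↾fun _ : PUnit => y))
    rw [Equiv.apply_symm_apply] at this
    exact (congrArg (fun k : PUnit ⟶ T.obj Y => k PUnit.unit) this).symm

namespace MonoidPresheaf

/-- Says that the regular `H`-set corepresents `T`. The corepresenting object `P` is indecomposable
because `T` preserves coproducts, and it maps to the regular set because `T` preserves epimorphisms.
-/
theorem exists_universal_element {H : Type w} [Group H] (T : MonoidPresheaf H ⥤ Type w)
    [hl : T.IsLeftAdjoint] [hr : T.IsRightAdjoint] :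
    ∃ b : T.obj (regular H), ∀ Y : MonoidPresheaf H,
      Function.Bijective fun y : Carrier Y => T.map (ofElt y) b := by
  obtain ⟨P, u, hu⟩ := exists_corepresenting T
  have hom_ext_of_map {Y : MonoidPresheaf H} {h k : P ⟶ Y} (e : T.map h u = T.map k u) : h = k :=
    (hu Y).1 e
  have hne : Nonempty (Carrier P) := by
    by_contra hP
    rw [not_nonempty_iff] at hP
    exact ((Types.initial_iff_empty _).1
      ⟨IsInitial.isInitialObj T P (isInitialOfIsEmpty P)⟩).false u
  obtain ⟨p⟩ := hne
  obtain ⟨q, a, ha⟩ : ∃ q, ∃ a : T.obj (orbit P q), T.map (orbitι P q) a = u := by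
    obtain ⟨⟨i⟩, a, ha⟩ := Types.jointly_surjective_of_isColimit
      (isColimitOfPreserves T (isColimitOrbits P)) u
    exact ⟨i, a, ha⟩
  obtain ⟨t, rfl⟩ := (hu _).2 a
  -- The universal element lives on one orbit, so the identity of `P` factors through that orbit and
  -- `P` is transitive.
  have ht : t ≫ orbitι P q = 𝟙 P := hom_ext_of_map (by simpa using ha)
  have htr (x y : Carrier P) : ∃ g, act P x g = y := by
    have htx (x : Carrier P) : (toFun t x).1 = x :=
      congrArg (fun k : P ⟶ P => toFun k x) ht
    obtain ⟨g, hg⟩ := Quotient.exact ((toFun t x).2.trans (toFun t y).2.symm)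
    rw [htx, htx] at hg
    exact ⟨g, hg⟩
  have hp : Epi (ofElt p) := epi_of_surjective _ (htr p)
  -- `T` is a left adjoint, so it keeps `ofElt p` epic and `u` lifts to the regular set.
  obtain ⟨b, hb⟩ := (epi_iff_surjective (T.map (ofElt p))).1 inferInstance u
  obtain ⟨s, hs⟩ := (hu _).2 b
  have hsurj : Epi s := epi_of_surjective _ fun (k : H) => by
    let h : H := toFun s p
    exact ⟨act P p (h⁻¹ * k), (toFun_act s p (h⁻¹ * k)).trans (mul_inv_cancel_left h k)⟩
  refine ⟨b, fun Y => ⟨fun y z hyz => ?_, fun z => ?_⟩⟩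
  · have : s ≫ ofElt y = s ≫ ofElt z := hom_ext_of_map (by
      dsimp at hs hyz
      simpa [hs] using hyz)
    rw [cancel_epi] at this
    rw [← toFun_ofElt_one y, this, toFun_ofElt_one]
  · obtain ⟨f, rfl⟩ := (hu Y).2 z
    refine ⟨toFun f p, ?_⟩
    dsimp
    rw [← ofElt_comp, ← hb]
    simp

/-! ### Essential geometric morphisms between toposes of presheaves on groups -/

variable {G : Type w} [Group G] {H : Type w} [Group H]

/-- Restriction of the action along a homomorphism. -/
abbrev restrict (f : G →* H) : MonoidPresheaf H ⥤ MonoidPresheaf G :=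
  (Functor.whiskeringLeft _ _ _).obj (SingleObj.mapHom _ _ f).op

/-- With `b` universal in `T` of the regular set, `f g` is the unique element of `H` with `θ (f g) =
b · g`. Naturality of `θ` along `ofElt y` makes `θ` equivariant, and injectivity of `θ` makes `f`
multiplicative. -/
theorem exists_iso_restrict (T : MonoidPresheaf H ⥤ MonoidPresheaf G)
    [hl : T.IsLeftAdjoint] [hr : T.IsRightAdjoint] :
    ∃ f : G →* H, Nonempty (restrict f ≅ T) := by
  have : (T ⋙ forget G).IsLeftAdjoint := inferInstance
  have : (T ⋙ forget G).IsRightAdjoint := inferInstance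
  obtain ⟨b, hb⟩ := exists_universal_element (T ⋙ forget G)
  let b' : Carrier (T.obj (regular H)) := b
  let θ (Y : MonoidPresheaf H) (y : Carrier Y) : Carrier (T.obj Y) := toFun (T.map (ofElt y)) b'
  have hθ (Y : MonoidPresheaf H) : Function.Bijective (θ Y) := hb Y
  have θ_nat {Y Z : MonoidPresheaf H} (η : Y ⟶ Z) (y : Carrier Y) :
      toFun (T.map η) (θ Y y) = θ Z (toFun η y) := by
    dsimp only [θ]
    rw [← ofElt_comp, T.map_comp, toFun_comp]
  choose f hf using fun g => (hθ (regular H)).2 (act _ b' g)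
  have θ_act (Y : MonoidPresheaf H) (y : Carrier Y) (g : G) :
      θ Y (act Y y (f g)) = act _ (θ Y y) g := by
    have := θ_nat (ofElt y) (f g)
    rw [hf, toFun_act] at this
    exact this.symm
  have hone : f 1 = (1 : H) := (hθ (regular H)).1 (by
    rw [hf, act_one]
    have : ofElt (Y := regular H) (1 : H) = 𝟙 _ := hom_ext_regular (mul_one (1 : H))
    change _ = toFun (T.map (ofElt _)) b'
    rw [this, T.map_id, toFun_id])
  let F : G →* H :=
    { toFun := f
      map_one' := hone
      map_mul' := fun g h => (hθ (regular H)).1 (by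
        rw [hf, act_mul, ← hf g, ← θ_act]
        rfl) }
  let α : restrict F ⟶ T :=
    { app := fun Y => homMk (Y := (restrict F).obj Y) (θ Y) (θ_act Y)
      naturality := fun Y Z η => hom_ext fun y => (θ_nat η y).symm }
  have (Y : MonoidPresheaf H) : IsIso (α.app Y) := isIso_of_bijective _ (hθ Y)
  have : IsIso α := NatIso.isIso_of_isIso_app α
  exact ⟨F, ⟨asIso α⟩⟩

end MonoidPresheaf

/-! ### Values and hom-categories of the presheaf pseudofunctor -/

namespace GrpTwo

theorem presheafTopos_isAtomicWithPoint (G : Co GrpTwo.{w}) :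
    (presheafTopos.obj G).IsAtomicWithPoint :=
  ⟨MonoidPresheaf.isAtomicTopos_of_group G.as.carrier,
    MonoidPresheaf.hasEssentialSurjectivePoint G.as.carrier⟩

open MonoidPresheaf in
-- Yoneda: `τ` is determined by the image `a` of 1 in the regular `H`-set. Computing `τ (f x)` by
-- equivariance and by the formula `y ↦ y · a` gives `a * g x = f x * a`.
theorem exists_conj_of_restrict_hom {G H : GrpTwo.{w}} {f g : G.carrier →* H.carrier}
    (τ : restrict f ⟶ restrict g) :
    ∃ α : Conj g f, τ = (Functor.whiskeringLeft _ _ _).map (NatTrans.op (Conj.toNatTrans α)) := by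
  let a : H.carrier := toFun (τ.app (regular H.carrier)) (1 : H.carrier)
  have hτ (Y : MonoidPresheaf H.carrier) (y : Carrier Y) : toFun (τ.app Y) y = act Y y a := by
    have := congrArg (fun k => toFun k (1 : H.carrier)) (τ.naturality (ofElt (M := H.carrier) y))
    exact (congrArg (toFun (τ.app Y)) (toFun_ofElt_one (M := H.carrier) y).symm).trans this
  refine ⟨⟨a, fun x => ?_⟩, ?_⟩
  · have h₁ : toFun (τ.app (regular H.carrier)) (f x) = a * g x :=
      (congrArg (toFun (τ.app (regular H.carrier))) (one_mul (f x)).symm).trans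
        (toFun_act (τ.app (regular H.carrier)) (1 : H.carrier) x)
    exact h₁.symm.trans (hτ (regular H.carrier) (f x))
  · ext Y : 2
    exact hom_ext fun y => hτ Y y

theorem isEquivalence_presheafTopos_mapFunctor (G H : Co GrpTwo.{w}) :
    (presheafTopos.mapFunctor G H).IsEquivalence where
  faithful := ⟨fun {f g} α β h => by
    -- Evaluation at 1 in the regular set recovers the conjugating element.
    have h₁ := congrArg (fun τ : (presheafTopos.map f) ⟶ (presheafTopos.map g) =>
      MonoidPresheaf.toFun ((Topos.Hom₂.trans τ).app (MonoidPresheaf.regular H.as.carrier))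
        (1 : H.as.carrier)) h
    have h₂ : (1 : H.as.carrier) * α.as.elt = 1 * β.as.elt := h₁
    exact Co.Hom₂.ext (Conj.ext (by simpa using h₂))⟩
  full := ⟨fun {f g} τ => by
    obtain ⟨α, hα⟩ := exists_conj_of_restrict_hom (f := f.as) (g := g.as) (Topos.Hom₂.trans τ)
    exact ⟨⟨α⟩, Topos.Hom₂.ext hα.symm⟩⟩
  essSurj := ⟨fun φ => by
    obtain ⟨f, ⟨e⟩⟩ := MonoidPresheaf.exists_iso_restrict (G := G.as.carrier) (H := H.as.carrier)
      φ.geom.inverse (hl := φ.geom.adj.isLeftAdjoint) (hr := φ.isEssential)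
    exact ⟨⟨f⟩, ⟨Topos.isoMk e⟩⟩⟩

end GrpTwo

/-! ### Passage to the full sub-2-category -/

theorem isEquivalence_liftToFullSub_mapFunctor {B : Type u₁} [Bicategory.{w₁, v₁} B]
    {C : Type u₂} [Bicategory.{w₂, v₂} C] (F : Pseudofunctor B C) (P : C → Prop)
    (hF : ∀ b, P (F.obj b)) (a b : B) (h : (F.mapFunctor a b).IsEquivalence) :
    ((liftToFullSub F P hF).mapFunctor a b).IsEquivalence where
  faithful := ⟨fun {f g α β} e => (F.mapFunctor a b).map_injective
    (congrArg (fun τ : InducedBicategory.Hom₂ ((liftToFullSub F P hF).map f)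
      ((liftToFullSub F P hF).map g) => τ.hom) e)⟩
  full := ⟨fun {f g} τ => by
    let τ' : InducedBicategory.Hom₂ ((liftToFullSub F P hF).map f)
      ((liftToFullSub F P hF).map g) := τ
    obtain ⟨α, hα⟩ := (F.mapFunctor a b).map_surjective (X := f) (Y := g) τ'.hom
    exact ⟨α, InducedBicategory.Hom₂.ext hα⟩⟩
  essSurj := ⟨fun φ => ⟨(F.mapFunctor a b).objPreimage φ.hom,
    ⟨InducedBicategory.isoMk ((F.mapFunctor a b).objObjPreimageIso φ.hom)⟩⟩⟩

/-- An equivalence in the ambient bicategory between objects of a full sub-2-category. -/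
def Bicategory.Equivalence.toFullSub {C : Type u₂} [Bicategory.{w₂, v₂} C] {P : C → Prop}
    {c d : FullSubTwoCat P} (f : c.1 ⟶ d.1) (g : d.1 ⟶ c.1) (η : 𝟙 c.1 ≅ f ≫ g)
    (θ : g ≫ f ≅ 𝟙 d.1) : Bicategory.Equivalence c d :=
  .mkOfAdjointifyCounit (f := InducedBicategory.mkHom f) (g := InducedBicategory.mkHom g)
    (InducedBicategory.isoMk η) (InducedBicategory.isoMk θ)

namespace Topos

/-- The essential geometric morphism given by an equivalence of categories. -/
def homOfEquivalence {E F : Topos.{w}} (e : E.carrier ≌ F.carrier) : E ⟶ F where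
  geom :=
    { direct := e.functor
      inverse := e.inverse
      adj := e.symm.toAdjunction
      preservesFiniteLimits := inferInstance }
  isEssential := inferInstanceAs e.inverse.IsRightAdjoint

/-- Inverse images compose in reverse order, so the round trip from `c` has inverse image `e.functor
⋙ e.inverse`, and the unit and counit of `e` fit as they stand. -/
theorem nonempty_equivalence_fullSub {P : Topos.{w} → Prop} {c d : FullSubTwoCat P}
    (e : c.1.carrier ≌ d.1.carrier) : Nonempty (Bicategory.Equivalence c d) :=
  ⟨Bicategory.Equivalence.toFullSub (homOfEquivalence e) (homOfEquivalence e.symm)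
    (isoMk e.unitIso) (isoMk e.counitIso)⟩

end Topos

/-! ### Categories with an essential surjective point -/

theorem isIso_app_of_isColimit {C : Type u₁} [Category.{v₁} C] {D : Type u₂} [Category.{v₂} D]
    {F G : C ⥤ D} (α : F ⟶ G) {J : Type u} [Category.{v} J] {K : J ⥤ C} {c : Cocone K}
    (hc : IsColimit c) [PreservesColimit K F] [PreservesColimit K G]
    (h : ∀ j, IsIso (α.app (K.obj j))) : IsIso (α.app c.pt) := by
  have : ∀ j, IsIso ((Functor.whiskerLeft K α).app j) := h
  have : IsIso (Functor.whiskerLeft K α) := NatIso.isIso_of_isIso_app _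
  let e := IsColimit.coconePointsIsoOfNatIso (isColimitOfPreserves F hc)
    (isColimitOfPreserves G hc) (asIso (Functor.whiskerLeft K α))
  have he : e.hom = α.app c.pt := (isColimitOfPreserves F hc).hom_ext fun j => by
    refine ((isColimitOfPreserves F hc).ι_map (G.mapCocone c) _ j).trans ?_
    exact (α.naturality (c.ι.app j)).symm
  rw [← he]
  infer_instance

/-- By a triangle identity `R` sends the counit to an inverse of the unit; since `R` is conservative
the counit is invertible too. -/
theorem isEquivalence_of_isIso_unit {C : Type u₁} [Category.{v₁} C] {D : Type u₂}
    [Category.{v₂} D] {L : C ⥤ D} {R : D ⥤ C} (adj : L ⊣ R) [R.ReflectsIsomorphisms]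
    (h : ∀ X, IsIso (adj.unit.app X)) : R.IsEquivalence := by
  have (Y : D) : IsIso (adj.counit.app Y) := by
    have h₁ : adj.unit.app (R.obj Y) ≫ R.map (adj.counit.app Y) = 𝟙 (R.obj Y) :=
      adj.right_triangle_components Y
    have : IsIso (adj.unit.app (R.obj Y) ≫ R.map (adj.counit.app Y)) := by
      rw [h₁]
      exact IsIso.id (R.obj Y)
    have : IsIso (R.map (adj.counit.app Y)) := IsIso.of_isIso_comp_left (adj.unit.app (R.obj Y)) _
    exact isIso_of_reflects_iso _ R
  exact adj.toEquivalence.isEquivalence_inverse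

namespace MonoidPresheaf

variable {E : Type u} [Category.{w} E]

/-- The functor that sends `X` to the set of morphisms `P ⟶ X`, with the right action of the
monoid of endomorphisms of `P`. -/
def homFunctor (P : E) : E ⥤ MonoidPresheaf (End P) where
  -- In `End P` the product `m * n` is `n ≫ m`, so precomposition is a right action.
  obj X := ofAct (P ⟶ X) (fun x (m : P ⟶ P) => m ≫ x) (fun x => Category.id_comp x)
    (fun x (m n : P ⟶ P) => Category.assoc n m x)
  map {X _} f := homMk (fun x : P ⟶ X => x ≫ f)
    (fun (x : P ⟶ X) (m : P ⟶ P) => Category.assoc m x f)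
  map_id X := hom_ext fun x => Category.comp_id (obj := E) (show P ⟶ X from x)
  map_comp {X _ _} f g := hom_ext fun x => (Category.assoc (obj := E) (show P ⟶ X from x) f g).symm

/-- Up to a universe lift this is the nerve of the inclusion of the one-object category `End P` in
`E`; its left adjoint is the realization, a left Kan extension along Yoneda. -/
theorem isRightAdjoint_homFunctor [HasColimitsOfSize.{w, w} E] (P : E) :
    (homFunctor P).IsRightAdjoint := by
  let A : SingleObj (End P) ⥤ E := SingleObj.functor (MonoidHom.id (End P))
  have : (Presheaf.restrictedULiftYoneda.{w} A).IsRightAdjoint :=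
    (Presheaf.uliftYonedaAdjunction.{w} _ (uliftYoneda.{w}.leftKanExtensionUnit A)).isRightAdjoint
  refine Functor.isRightAdjoint_of_iso (F := Presheaf.restrictedULiftYoneda.{w} A)
    (NatIso.ofComponents (fun X => NatIso.ofComponents (fun c => Equiv.ulift.toIso) ?_) ?_)
  · intros
    rfl
  · intros
    rfl

/-- Maps `L (regular) ⟶ X` correspond to elements of `Hom(P, X)` by composition with `u`, so `u` is
invertible by Yoneda. The unit is `m ↦ m ≫ u`, hence bijective. -/
theorem isIso_unit_app_regular {P : E} {L : MonoidPresheaf (End P) ⥤ E}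
    (adj : L ⊣ homFunctor P) : IsIso (adj.unit.app (regular (End P))) := by
  let u : P ⟶ L.obj (regular (End P)) :=
    toFun (adj.unit.app (regular (End P))) (1 : End P)
  have hcomp {X : E} (h : L.obj (regular (End P)) ⟶ X) :
      u ≫ h = toFun (adj.homEquiv _ _ h) (1 : End P) := by
    rw [adj.homEquiv_unit]
    rfl
  have : IsIso u := by
    rw [isIso_iff_coyoneda_map_bijective]
    intro X
    refine ⟨fun h k e => ?_, fun x => ?_⟩
    · have e' : u ≫ h = u ≫ k := e
      rw [hcomp, hcomp] at e'
      exact (adj.homEquiv _ _).injective (hom_ext_regular e')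
    · refine ⟨(adj.homEquiv _ _).symm (ofElt (Y := (homFunctor P).obj X) x), ?_⟩
      refine (hcomp _).trans ?_
      rw [Equiv.apply_symm_apply]
      exact toFun_ofElt_one (Y := (homFunctor P).obj X) x
  refine isIso_of_bijective _ ⟨fun (m n : P ⟶ P) e => ?_, fun x => ?_⟩
  · have e' : m ≫ u = n ≫ u :=
      (toFun_regular (M := End P) _ m).symm.trans (e.trans (toFun_regular (M := End P) _ n))
    exact (cancel_mono u).1 e'
  · let x' : P ⟶ L.obj (regular (End P)) := x
    let m : End P := x' ≫ inv u
    refine ⟨m, (toFun_regular _ m).trans ?_⟩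
    have : (x' ≫ inv u) ≫ u = x' := by simp
    exact this

/-- Each presheaf is a colimit of copies of the regular one, and both ends of the unit preserve
colimits, so invertibility spreads from the regular set to all presheaves. -/
theorem isEquivalence_homFunctor [HasColimitsOfSize.{w, w} E] (P : E)
    [PreservesColimitsOfSize.{w, w} (homFunctor P)] [(homFunctor P).ReflectsIsomorphisms] :
    (homFunctor P).IsEquivalence := by
  obtain ⟨L, ⟨adj⟩⟩ := (isRightAdjoint_homFunctor P).exists_leftAdjoint
  have : PreservesColimitsOfSize.{w, w} L := adj.leftAdjoint_preservesColimits
  refine isEquivalence_of_isIso_unit adj fun Y => ?_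
  refine isIso_app_of_isColimit adj.unit (Presheaf.colimitOfRepresentable.{w} Y) fun j => ?_
  let e : regular (End P) ≅ (Presheaf.functorToRepresentables.{w} Y).obj j :=
    NatIso.ofComponents (fun c => Equiv.ulift.symm.toIso) (fun _ => rfl)
  have := isIso_unit_app_regular adj
  exact (NatTrans.isIso_app_iff_of_iso adj.unit e).1 this

theorem exists_equivalence_of_essential_point [HasColimitsOfSize.{w, w} E] (T : E ⥤ Type w)
    [T.IsLeftAdjoint] [T.IsRightAdjoint] [T.ReflectsIsomorphisms] :
    ∃ P : E, Nonempty (E ≌ MonoidPresheaf (End P)) := by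
  obtain ⟨P, u, hu⟩ := exists_corepresenting T
  let α : homFunctor P ⋙ forget (End P) ⟶ T :=
    { app := fun X => ↾fun h : P ⟶ X => T.map h u
      naturality := fun X Y f => by
        ext h
        exact congrArg (fun k : T.obj P ⟶ T.obj Y => k u) (T.map_comp h f) }
  have (X : E) : IsIso (α.app X) := (isIso_iff_bijective _).2 (hu X)
  have : IsIso α := NatIso.isIso_of_isIso_app α
  have : (homFunctor P ⋙ forget (End P)).ReflectsIsomorphisms :=
    reflectsIsomorphisms_of_iso (asIso α).symm
  have : (homFunctor P).ReflectsIsomorphisms := reflectsIsomorphisms_of_comp _ (forget (End P))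
  have : PreservesColimitsOfSize.{w, w} T :=
    (Adjunction.ofIsLeftAdjoint T).leftAdjoint_preservesColimits
  have : PreservesColimitsOfSize.{w, w} (homFunctor P ⋙ forget (End P)) :=
    preservesColimits_of_natIso (asIso α).symm
  -- Colimits of presheaves are computed pointwise and there is only one object.
  have : PreservesColimitsOfSize.{w, w} (homFunctor P) :=
    preservesColimits_of_evaluation _ fun _ => this
  have := isEquivalence_homFunctor P
  exact ⟨P, ⟨(homFunctor P).asEquivalence⟩⟩

end MonoidPresheaf

/-! ### Recovering the group from the topos -/

theorem IsGrothendieckTopos.hasColimits {E : Type (w + 1)} [Category.{w} E]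
    (h : IsGrothendieckTopos.{w} E) : HasColimitsOfSize.{w, w} E := by
  obtain ⟨C, _, J, ⟨e⟩⟩ := h
  have : HasSheafify J (Type w) := inferInstance
  have : HasColimitsOfSize.{w, w} (Sheaf J (Type w)) := by
    have : HasColimitsOfSize.{w, w} (Type w) := inferInstance
    exact ⟨fun K => inferInstance⟩
  exact Adjunction.has_colimits_of_equivalence e.functor

/-- The inverse image is the comparison equivalence followed by the forgetful functor from
coalgebras, which is conservative. -/
theorem GeomMorphism.IsSurjective.reflectsIsomorphisms {E : Type u₁} [Category.{v₁} E]
    {F : Type u₂} [Category.{v₂} F] {φ : GeomMorphism E F} (h : φ.IsSurjective) :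
    φ.inverse.ReflectsIsomorphisms := by
  have : (Comonad.comparison φ.adj).IsEquivalence := h
  have : (Comonad.comparison φ.adj ⋙ φ.adj.toComonad.forget).ReflectsIsomorphisms := inferInstance
  exact this

theorem Topos.IsAtomicWithPoint.exists_equivalence {E : Topos.{w}} (h : E.IsAtomicWithPoint) :
    ∃ (G : Type w) (_ : Group G), Nonempty (MonoidPresheaf G ≌ E.carrier) := by
  obtain ⟨hat, φ, hess, hsurj⟩ := h
  have := E.isGrothendieckTopos.hasColimits
  have := hsurj.reflectsIsomorphisms
  have : φ.inverse.IsRightAdjoint := hess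
  have : φ.inverse.IsLeftAdjoint := φ.adj.isLeftAdjoint
  obtain ⟨P, ⟨e⟩⟩ := MonoidPresheaf.exists_equivalence_of_essential_point φ.inverse
  have hunit := MonoidPresheaf.isUnit_of_isAtomicTopos (hat.of_equivalence e)
  exact ⟨End P, groupOfIsUnit hunit, ⟨e.symm⟩⟩

theorem isTwoEquivalence_presheafTopos :
    IsTwoEquivalence (liftToFullSub GrpTwo.presheafTopos.{w} Topos.IsAtomicWithPoint
      GrpTwo.presheafTopos_isAtomicWithPoint) where
  locally_equivalence G H := isEquivalence_liftToFullSub_mapFunctor _ _ _ G H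
    (GrpTwo.isEquivalence_presheafTopos_mapFunctor G H)
  essentially_surjective c := by
    obtain ⟨G, _, ⟨e⟩⟩ := c.2.exists_equivalence
    exact ⟨⟨⟨G⟩⟩, Topos.nonempty_equivalence_fullSub e⟩

theorem mainTheorem5 :
    (∃ h : ∀ G : Co GrpTwo.{w}, (GrpTwo.presheafTopos.obj G).IsAtomicWithPoint,
      IsTwoEquivalence
        (liftToFullSub GrpTwo.presheafTopos.{w} Topos.IsAtomicWithPoint h) ∧
      IsTwoEquivalence
        (GrpTwo.toCo.{w}.comp
          (liftToFullSub GrpTwo.presheafTopos.{w} Topos.IsAtomicWithPoint h))) ∧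
    IsTwoEquivalence GrpTwo.toCo.{w} ∧
    (∀ (M : Type w) [Monoid M], IsAtomicTopos (MonoidPresheaf M) ↔ ∀ m : M, IsUnit m) :=
  ⟨⟨GrpTwo.presheafTopos_isAtomicWithPoint, isTwoEquivalence_presheafTopos,
    GrpTwo.isTwoEquivalence_toCo_comp _ isTwoEquivalence_presheafTopos⟩,
    GrpTwo.isTwoEquivalence_toCo, fun _ _ => MonoidPresheaf.isAtomicTopos_iff⟩
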